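/- Let $\mathcal{S}_n$ be the space of $n\times n$ real symmetric matrices. A matrix $A\in\mathcal{S}_n$ is called austere if its nonzero eigenvalues, counted with multiplicity, occur in oppositely signed pairs; a linear subspace $\mathcal{Q}\subset M(n,\mathbb{R})$ is called austere if it consists of austere (in particular symmetric) matrices. Let $S(n,\mathbb{R})$ be the unit sphere, with respect to the Frobenius norm, in the space of traceless matrices of $\mathcal{S}_n$. With $q=\lfloor (n-1)/2\rfloor$, let $$\Phi_n: S(n,\mathbb{R})\to\mathbb{R}^{q},\qquad A\mapsto(\operatorname{tr}A^3,\operatorname{tr}A^5,\dots,\operatorname{tr}A^{2q+1}),$$ and let $\mathcal{B}_{n,\mathbb{R}}$ be the set of those $A\in\Phi_n^{-1}(0)$ that are regular points of $\Phi_n$ (the differential of $\Phi_n$ at $A$ is surjective). Let $\mathcal{Q}\subset M(n,\mathbb{R})$ be an austere subspace with $\mathcal{Q}\cap\mathcal{B}_{n,\mathbb{R}}\neq\varnothing$, and let $p\ge 0$ be an integer. Then $$\dim\mathcal{Q}\le\begin{cases}p^2+2p&\text{if }n=2p+1,\\ p^2+3p+2&\text{if }n=2p+2.\end{cases}$$ Moreover,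 for every $p\ge0$ and $n=2p+2$, equality is attained: the space $$\left\{\begin{pmatrix}m_1&m_2\\ m_2&-m_1\end{pmatrix}: m_1,m_2\in\mathcal{S}_{p+1}\right\}$$ is an austere subspace, maximal among austere subspaces of $M(n,\mathbb{R})$ with respect to inclusion, it meets $\mathcal{B}_{n,\mathbb{R}}$, and its dimension is $p^2+3p+2$. -/

import Mathlib

open scoped Manifold Matrix

noncomputable section

namespace Austere

/-- A real square matrix is austere if it is symmetric and its nonzero eigenvalues, counted with
multiplicity, occur in oppositely signed pairs. -/
def IsAustere {n : ℕ} (A : Matrix (Fin n) (Fin n) ℝ) : Prop :=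
  A.IsSymm ∧ ∀ t : ℝ, t ≠ 0 → A.charpoly.roots.count t = A.charpoly.roots.count (-t)

/-- An austere subspace is a linear subspace of `M(n, ℝ)` consisting of austere matrices. -/
def IsAustereSubspace {n : ℕ} (Q : Submodule ℝ (Matrix (Fin n) (Fin n) ℝ)) : Prop :=
  ∀ A ∈ Q, IsAustere A

/-- The space `E(n, ℝ)` of traceless symmetric real matrices. -/
def tracelessSymm (n : ℕ) : Submodule ℝ (Matrix (Fin n) (Fin n) ℝ) where
  carrier := {A | A.IsSymm ∧ A.trace = 0}
  add_mem' := fun ha hb => ⟨ha.1.add hb.1, by rw [Matrix.trace_add, ha.2, hb.2, add_zero]⟩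
  zero_mem' := ⟨Matrix.isSymm_zero, Matrix.trace_zero _ _⟩
  smul_mem' := fun c _ ha => ⟨ha.1.smul c, by rw [Matrix.trace_smul, ha.2, smul_zero]⟩

section Frobenius

attribute [local instance] Matrix.frobeniusNormedAddCommGroup Matrix.frobeniusNormedSpace

/-- The Frobenius inner product `⟨A, B⟩ = tr (Aᵀ B)`, which induces Mathlib's Frobenius norm. -/
@[reducible]
def frobeniusInner (n : ℕ) : InnerProductSpace ℝ (Matrix (Fin n) (Fin n) ℝ) where
  inner A B := (Aᵀ * B).trace
  norm_sq_eq_re_inner A := by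
    have h : (0 : ℝ) ≤ ∑ i, ∑ j, A i j ^ 2 :=
      Finset.sum_nonneg fun i _ => Finset.sum_nonneg fun j _ => sq_nonneg _
    have h2 : ‖A‖ ^ 2 = ∑ i, ∑ j, A i j ^ 2 := by
      rw [Matrix.frobenius_norm_def, ← Real.sqrt_eq_rpow]
      simp only [Real.rpow_two, Real.norm_eq_abs, sq_abs]
      exact Real.sq_sqrt h
    rw [h2, Finset.sum_comm]
    simp [Matrix.trace, Matrix.mul_apply, sq]
  conj_inner_symm A B := by
    have h : (Bᵀ * A).trace = (Aᵀ * B).trace := by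
      rw [← Matrix.trace_transpose (Bᵀ * A), Matrix.transpose_mul, Matrix.transpose_transpose]
    simpa using h
  add_left A B C := by simp [Matrix.add_mul]
  smul_left A B r := by simp

attribute [local instance] frobeniusInner

/-- `E(n, ℝ)` as a Euclidean space: the traceless symmetric matrices with the Frobenius inner
product. A type synonym, so that its topology is the one given by the Frobenius norm. -/
def E (n : ℕ) : Type := tracelessSymm n

instance (n : ℕ) : NormedAddCommGroup (E n) :=
  inferInstanceAs (NormedAddCommGroup (tracelessSymm n))

instance (n : ℕ) : InnerProductSpace ℝ (E n) :=
  inferInstanceAs (InnerProductSpace ℝ (tracelessSymm n))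

instance (n : ℕ) : FiniteDimensional ℝ (E n) :=
  inferInstanceAs (FiniteDimensional ℝ (tracelessSymm n))

/-- The inclusion of `E(n, ℝ)` in the space of matrices. -/
def E.toMatrix {n : ℕ} : E n →ₗ[ℝ] Matrix (Fin n) (Fin n) ℝ := (tracelessSymm n).subtype

end Frobenius

/-- `S(n, ℝ)`: the unit sphere of `E(n, ℝ)` for the Frobenius norm. -/
abbrev unitSphere (n : ℕ) : Set (E n) := Metric.sphere (0 : E n) 1

/-- The map `Φ : S(n, ℝ) → ℝ^p`, `A ↦ (tr A³, tr A⁵, …, tr A^(2p+1))`, with `p = ⌊(n - 1) / 2⌋`. -/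
def Phi (n : ℕ) (A : unitSphere n) : EuclideanSpace ℝ (Fin ((n - 1) / 2)) :=
  WithLp.toLp 2 fun k => ((A : E n).toMatrix ^ (2 * ((k : ℕ) + 1) + 1)).trace

lemma finrank_eq {n : ℕ} (A : unitSphere n) :
    Module.finrank ℝ (E n) = (Module.finrank ℝ (E n) - 1) + 1 := by
  have hA : (A : E n) ≠ 0 := ne_zero_of_mem_unit_sphere A
  have : Nontrivial (E n) := ⟨⟨_, _, hA⟩⟩
  have h : 0 < Module.finrank ℝ (E n) := Module.finrank_pos
  omega

/-- `A` is a regular point of `Φ`: the differential of `Φ` at `A`, as a map between the manifolds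
`S(n, ℝ)` and `ℝ^p`, is surjective. -/
def IsRegularPoint {n : ℕ} (A : unitSphere n) : Prop :=
  haveI : Fact (Module.finrank ℝ (E n) = (Module.finrank ℝ (E n) - 1) + 1) := ⟨finrank_eq A⟩
  Function.Surjective
    (mfderiv (𝓡 (Module.finrank ℝ (E n) - 1))
      𝓘(ℝ, EuclideanSpace ℝ (Fin ((n - 1) / 2))) (Phi n) A)

/-- `𝓑_{n, ℝ}`: the regular points of `Φ` in `Φ⁻¹(0)`, as a set of matrices. -/
def regularSet (n : ℕ) : Set (Matrix (Fin n) (Fin n) ℝ) :=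
  {M | ∃ A : unitSphere n, (A : E n).toMatrix = M ∧ Phi n A = 0 ∧ IsRegularPoint A}

/-- The block matrix `(m₁ m₂; m₂ -m₁)`, with rows and columns numbered by `Fin (2 * k)`. -/
def blockMatrix {k : ℕ} (m₁ m₂ : Matrix (Fin k) (Fin k) ℝ) :
    Matrix (Fin (2 * k)) (Fin (2 * k)) ℝ :=
  Matrix.reindex (finSumFinEquiv.trans (finCongr (two_mul k).symm))
    (finSumFinEquiv.trans (finCongr (two_mul k).symm)) (Matrix.fromBlocks m₁ m₂ m₂ (-m₁))

/-- The space of all matrices `(m₁ m₂; m₂ -m₁)` with `m₁`, `m₂` symmetric `k × k` matrices. -/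
def blockSubspace (k : ℕ) : Submodule ℝ (Matrix (Fin (2 * k)) (Fin (2 * k)) ℝ) where
  carrier := {A | ∃ m₁ m₂ : Matrix (Fin k) (Fin k) ℝ,
    m₁.IsSymm ∧ m₂.IsSymm ∧ A = blockMatrix m₁ m₂}
  add_mem' := by
    rintro _ _ ⟨a, b, ha, hb, rfl⟩ ⟨c, d, hc, hd, rfl⟩
    refine ⟨a + c, b + d, ha.add hc, hb.add hd, ?_⟩
    have h := Matrix.fromBlocks_add a b b (-a) c d d (-c)
    rw [← neg_add] at h
    simp only [blockMatrix, ← h]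
    rfl
  zero_mem' := by
    refine ⟨0, 0, Matrix.isSymm_zero, Matrix.isSymm_zero, ?_⟩
    simp [blockMatrix]
  smul_mem' := by
    rintro c _ ⟨a, b, ha, hb, rfl⟩
    refine ⟨c • a, c • b, ha.smul c, hb.smul c, ?_⟩
    have h := Matrix.fromBlocks_smul c a b b (-a)
    rw [smul_neg] at h
    simp only [blockMatrix, ← h]
    rfl

end Austere

end

/-!
A point `A` of `Φ⁻¹(0)` is regular exactly when `1, A², A⁴, …, A^(2q)` are linearly independent, so
by Vandermonde the eigenvalues `a 0 ≥ a 1 ≥ ⋯` of an austere regular `A`, which satisfy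
`a (n - 1 - i) = -a i`, have no further coincidences up to sign.

Let `Q` be austere and contain `A = diagonal a`. Differentiating `tr ((A + t B)^(2k+1)) = 0` at
`t = 0` gives `tr (A^(2k) B) = 0` for `B ∈ Q`, hence `B i i + B (n-1-i) (n-1-i) = 0`; polarizing the
case `k = 1` gives `tr (A B²) = 0`, that is `∑ i j, (a i + a j) (B i j)² = 0`. All pairs `(i, j)`
strictly below the antidiagonal have `a i + a j < 0` unless `i = j`, so `B` vanishes as soon as its
entries on and above the antidiagonal do. By symmetry of `B`, this bounds `dim Q` by a count of
entries. The block space reaches the bound, which makes it maximal.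
-/

namespace Austere

section LinearIndependence

lemma linearIndependent_pow_iff_injective {K : Type*} [Field K] {m : ℕ} (v : Fin m → K) :
    (LinearIndependent K fun k : Fin m => v ^ (k : ℕ)) ↔ Function.Injective v := by
  rw [← Matrix.det_vandermonde_ne_zero_iff, ← isUnit_iff_ne_zero, ← Matrix.isUnit_iff_isUnit_det,
    ← Matrix.linearIndependent_cols_iff_isUnit]
  rfl

lemma sum_filter_eq_zero_of_sum_pow_mul_eq_zero {K ι : Type*} [Field K] [DecidableEq K] [Fintype ι]
    {f d : ι → K} (h : ∀ k : ℕ, ∑ i, f i ^ k * d i = 0) (x : K) :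
    ∑ i with f i = x, d i = 0 := by
  have hpoly (P : Polynomial K) : ∑ i, P.eval (f i) * d i = 0 := by
    simp only [Polynomial.eval_eq_sum_range, Finset.sum_mul, mul_assoc]
    rw [Finset.sum_comm]
    simp only [← Finset.mul_sum, h, mul_zero, Finset.sum_const_zero]
  let P := Lagrange.interpolate (Finset.univ.image f) id (Pi.single x 1)
  have hP (i : ι) : P.eval (f i) = if f i = x then 1 else 0 := by
    exact (Lagrange.eval_interpolate_at_node _ (Set.injOn_id _)
      (Finset.mem_image_of_mem f (Finset.mem_univ i))).trans (Pi.single_apply x 1 (f i))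
  simpa only [hP, ite_mul, one_mul, zero_mul, ← Finset.sum_filter] using hpoly P

lemma exists_forall_inner_sum_smul_eq {𝕜 ι F : Type*} [RCLike 𝕜] [Fintype ι]
    [NormedAddCommGroup F] [InnerProductSpace 𝕜 F] {v : ι → F} (hv : LinearIndependent 𝕜 v)
    (c : ι → 𝕜) : ∃ x : ι → 𝕜, ∀ i, inner 𝕜 (v i) (∑ j, x j • v j) = c i := by
  classical
  have hunit : IsUnit (Matrix.gram 𝕜 v) := by
    rw [Matrix.isUnit_iff_isUnit_det, isUnit_iff_ne_zero]
    exact Matrix.det_gram_ne_zero_iff_linearIndependent.mpr hv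
  obtain ⟨x, hx⟩ := Matrix.mulVec_surjective_iff_isUnit.mpr hunit c
  refine ⟨x, fun i => ?_⟩
  simp only [inner_sum, inner_smul_right, ← hx, Matrix.mulVec, dotProduct, Matrix.gram_apply,
    mul_comm]

end LinearIndependence

section Diagonalization

lemma charpoly_conjStarAlgAut {ι R : Type*} [Fintype ι] [DecidableEq ι] [CommRing R] [StarRing R]
    (V : Matrix.unitaryGroup ι R) (A : Matrix ι ι R) :
    (Unitary.conjStarAlgAut R _ V A).charpoly = A.charpoly := by
  rw [Unitary.conjStarAlgAut_apply, Matrix.charpoly_mul_comm, ← mul_assoc,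
    Unitary.coe_star_mul_self, one_mul]

lemma trace_conjStarAlgAut {ι R : Type*} [Fintype ι] [DecidableEq ι] [CommRing R] [StarRing R]
    (V : Matrix.unitaryGroup ι R) (A : Matrix ι ι R) :
    (Unitary.conjStarAlgAut R _ V A).trace = A.trace :=
  Matrix.trace_units_conj (Unitary.toUnits V) A

lemma isSymm_conjStarAlgAut_iff {ι : Type*} [Fintype ι] [DecidableEq ι]
    (V : Matrix.orthogonalGroup ι ℝ) {A : Matrix ι ι ℝ} :
    (Unitary.conjStarAlgAut ℝ _ V A).IsSymm ↔ A.IsSymm := by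
  simp only [Matrix.IsSymm, ← Matrix.conjTranspose_eq_transpose_of_trivial,
    ← Matrix.star_eq_conjTranspose, ← map_star, EmbeddingLike.apply_eq_iff_eq]

lemma exists_antitone_eq_conjStarAlgAut_diagonal {n : ℕ} {A : Matrix (Fin n) (Fin n) ℝ}
    (hA : A.IsSymm) :
    ∃ (V : Matrix.orthogonalGroup (Fin n) ℝ) (a : Fin n → ℝ),
      Antitone a ∧ A = Unitary.conjStarAlgAut ℝ _ V (Matrix.diagonal a) := by
  have hH : A.IsHermitian := (Matrix.conjTranspose_eq_transpose_of_trivial A).trans hA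
  let U : Matrix.orthogonalGroup (Fin n) ℝ := hH.eigenvectorUnitary
  let τ : Equiv.Perm (Fin n) := Fin.revPerm.trans (Tuple.sort hH.eigenvalues)
  have hV : U.1.submatrix id τ ∈ Matrix.orthogonalGroup (Fin n) ℝ := by
    rw [Matrix.mem_unitaryGroup_iff, Matrix.star_eq_conjTranspose,
      Matrix.conjTranspose_submatrix, Matrix.submatrix_mul_equiv, Matrix.submatrix_id_id]
    exact Matrix.mem_unitaryGroup_iff.mp U.2
  refine ⟨⟨_, hV⟩, hH.eigenvalues ∘ τ,
    fun i j hij => Tuple.monotone_sort hH.eigenvalues (Fin.rev_le_rev.mpr hij), ?_⟩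
  rw [Unitary.conjStarAlgAut_apply, ← Matrix.submatrix_diagonal_equiv,
    Matrix.star_eq_conjTranspose, Matrix.conjTranspose_submatrix, Matrix.submatrix_mul_equiv,
    Matrix.submatrix_mul_equiv, Matrix.submatrix_id_id]
  exact hH.spectral_theorem

lemma roots_charpoly_diagonal {ι R : Type*} [Fintype ι] [DecidableEq ι] [CommRing R] [IsDomain R]
    (a : ι → R) :
    (Matrix.diagonal a).charpoly.roots = Finset.univ.val.map a := by
  rw [Matrix.charpoly_diagonal, Finset.prod_eq_multiset_prod,
    ← Polynomial.roots_multiset_prod_X_sub_C (Finset.univ.val.map a), Multiset.map_map]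
  rfl

lemma charpoly_neg {ι R : Type*} [Fintype ι] [DecidableEq ι] [CommRing R] (A : Matrix ι ι R) :
    (-A).charpoly = (-1) ^ Fintype.card ι * A.charpoly.comp (-Polynomial.X) := by
  rw [← Polynomial.coe_compRingHom_apply, Matrix.charpoly, Matrix.charpoly, RingHom.map_det,
    ← Matrix.det_neg]
  congr 1
  ext1 i j
  rcases eq_or_ne i j with rfl | hij
  · simp [add_comm]
  · simp [Matrix.charmatrix_apply_ne _ _ _ hij]

lemma roots_charpoly_neg {ι R : Type*} [Fintype ι] [DecidableEq ι] [CommRing R] [IsDomain R]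
    (A : Matrix ι ι R) :
    (-A).charpoly.roots = A.charpoly.roots.map fun x => -x := by
  rcases neg_one_pow_eq_or (Polynomial R) (Fintype.card ι) with h | h <;>
    simp [charpoly_neg, h, Polynomial.roots_comp_neg_X]

end Diagonalization

section AustereMatrices

variable {n : ℕ} {A : Matrix (Fin n) (Fin n) ℝ}

lemma isAustere_iff_map_neg_roots :
    IsAustere A ↔ A.IsSymm ∧ (A.charpoly.roots.map fun x => -x) = A.charpoly.roots := by
  have hcount (t : ℝ) :
      (A.charpoly.roots.map fun x => -x).count t = A.charpoly.roots.count (-t) := by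
    rw [← Multiset.count_map_eq_count' (fun x : ℝ => -x) _ neg_injective (-t), neg_neg]
  rw [IsAustere, Multiset.ext]
  refine and_congr_right fun _ => ⟨fun h t => ?_, fun h t _ => (h t).symm.trans (hcount t)⟩
  rcases eq_or_ne t 0 with rfl | ht
  · rw [hcount, neg_zero]
  · rw [hcount, h t ht]

lemma isAustere_conjStarAlgAut_iff (V : Matrix.orthogonalGroup (Fin n) ℝ) :
    IsAustere (Unitary.conjStarAlgAut ℝ _ V A) ↔ IsAustere A := by
  rw [IsAustere, IsAustere, isSymm_conjStarAlgAut_iff, charpoly_conjStarAlgAut]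

lemma IsAustere.apply_rev_eq_neg {a : Fin n → ℝ} (hA : IsAustere (Matrix.diagonal a))
    (ha : Antitone a) (i : Fin n) : a i.rev = -a i := by
  have hroots := (isAustere_iff_map_neg_roots.mp hA).2
  rw [roots_charpoly_diagonal, Multiset.map_map, ← Multiset.map_univ_val_equiv Fin.revPerm,
    Multiset.map_map, Multiset.map_univ_val_equiv Fin.revPerm, Fin.univ_val_map, Fin.univ_val_map,
    Multiset.coe_eq_coe] at hroots
  have hanti : Antitone fun i : Fin n => -a i.rev :=
    fun i j hij => neg_le_neg (ha (Fin.rev_le_rev.mpr hij))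
  have hofFn := List.Perm.eq_of_sortedGE (List.sortedGE_ofFn_iff.mpr hanti)
    (List.sortedGE_ofFn_iff.mpr ha) hroots
  exact neg_eq_iff_eq_neg.mp (congrFun (List.ofFn_injective hofFn) i)

lemma IsAustere.trace_pow_eq_zero (hA : IsAustere A) {m : ℕ} (hm : Odd m) : (A ^ m).trace = 0 := by
  obtain ⟨V, a, ha, rfl⟩ := exists_antitone_eq_conjStarAlgAut_diagonal hA.1
  have harev := ((isAustere_conjStarAlgAut_iff V).mp hA).apply_rev_eq_neg ha
  rw [← map_pow, trace_conjStarAlgAut, Matrix.diagonal_pow, Matrix.trace_diagonal]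
  have hsum := Equiv.sum_comp Fin.revPerm fun i => a i ^ m
  simp only [Fin.revPerm_apply, harev, hm.neg_pow, Finset.sum_neg_distrib] at hsum
  exact self_eq_neg.mp hsum.symm

end AustereMatrices

section TracePowers

attribute [local instance] Matrix.frobeniusNormedRing Matrix.frobeniusNormedAlgebra

variable {ι : Type*} [Fintype ι] [DecidableEq ι]

/-- The functional `B ↦ tr (A ^ m * B)`: up to the factor `m + 1`, the differential at `A` of
`M ↦ tr (M ^ (m + 1))`. -/
noncomputable def tracePowMul (A : Matrix ι ι ℝ) (m : ℕ) : Matrix ι ι ℝ →L[ℝ] ℝ :=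
  LinearMap.toContinuousLinearMap (Matrix.traceLinearMap ι ℝ ℝ ∘ₗ LinearMap.mulLeft ℝ (A ^ m))

lemma hasFDerivAt_trace_pow (A : Matrix ι ι ℝ) (m : ℕ) :
    HasFDerivAt (fun M : Matrix ι ι ℝ => (M ^ (m + 1)).trace) ((m + 1 : ℝ) • tracePowMul A m)
      A := by
  let tr := LinearMap.toContinuousLinearMap (Matrix.traceLinearMap ι ℝ ℝ)
  refine (tr.hasFDerivAt.comp A (hasFDerivAt_pow' (m + 1))).congr_fderiv ?_
  ext B
  have hcyclic (i : ℕ) (hi : i ∈ Finset.range (m + 1)) :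
      tr (A ^ (m - i) * B * A ^ i) = (A ^ m * B).trace := by
    change Matrix.trace _ = _
    rw [Matrix.trace_mul_comm, ← mul_assoc, ← pow_add,
      Nat.add_sub_cancel' (Finset.mem_range_succ_iff.mp hi)]
  calc tr ((∑ i ∈ Finset.range (m + 1),
        MulOpposite.op (A ^ i) • A ^ (m - i) • ContinuousLinearMap.id ℝ (Matrix ι ι ℝ)) B)
      = ∑ i ∈ Finset.range (m + 1), tr (A ^ (m - i) * B * A ^ i) := by
        rw [_root_.sum_apply, map_sum]; rfl
    _ = (m + 1 : ℝ) * (A ^ m * B).trace := by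
        rw [Finset.sum_congr rfl hcyclic, Finset.sum_const, Finset.card_range, nsmul_eq_mul,
          Nat.cast_add_one]

lemma hasDerivAt_trace_add_smul_pow (A B : Matrix ι ι ℝ) (m : ℕ) :
    HasDerivAt (fun t : ℝ => ((A + t • B) ^ (m + 1)).trace) ((m + 1) * (A ^ m * B).trace) 0 := by
  have hline : HasDerivAt (fun t : ℝ => A + t • B) ((1 : ℝ) • B) 0 :=
    ((hasDerivAt_id (0 : ℝ)).smul_const B).const_add A
  rw [one_smul] at hline
  have htrace := hasFDerivAt_trace_pow (A + (0 : ℝ) • B) m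
  rw [zero_smul, add_zero] at htrace
  exact htrace.comp_hasDerivAt_of_eq (0 : ℝ) hline (by rw [zero_smul, add_zero])

end TracePowers

namespace IsAustereSubspace

variable {n : ℕ} {Q : Submodule ℝ (Matrix (Fin n) (Fin n) ℝ)} {A B : Matrix (Fin n) (Fin n) ℝ}

lemma trace_pow_mul_eq_zero (hQ : IsAustereSubspace Q) (hA : A ∈ Q) (hB : B ∈ Q) {m : ℕ}
    (hm : Even m) : (A ^ m * B).trace = 0 := by
  have hderiv := hasDerivAt_trace_add_smul_pow A B m
  have hconst (t : ℝ) : ((A + t • B) ^ (m + 1)).trace = 0 :=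
    (hQ _ (Q.add_mem hA (Q.smul_mem t hB))).trace_pow_eq_zero hm.add_one
  simp only [hconst] at hderiv
  exact (mul_eq_zero.mp (hderiv.unique (hasDerivAt_const 0 0))).resolve_left (by positivity)

-- Polarization of `tr (M ^ 2 * B) = 0`, at `M = A + B`.
lemma trace_mul_sq_eq_zero (hQ : IsAustereSubspace Q) (hA : A ∈ Q) (hB : B ∈ Q) :
    (A * (B * B)).trace = 0 := by
  have hAB := hQ.trace_pow_mul_eq_zero (Q.add_mem hA hB) hB even_two
  have hcycle : (B * A * B).trace = (A * (B * B)).trace := by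
    rw [Matrix.mul_assoc, Matrix.trace_mul_comm, Matrix.mul_assoc]
  have hexpand : (A + B) ^ 2 * B = A ^ 2 * B + A * (B * B) + B * A * B + B ^ 2 * B := by
    noncomm_ring
  rw [hexpand, Matrix.trace_add, Matrix.trace_add, Matrix.trace_add, hcycle,
    hQ.trace_pow_mul_eq_zero hA hB even_two, hQ.trace_pow_mul_eq_zero hB hB even_two] at hAB
  linarith

end IsAustereSubspace

section RegularPoints

attribute [local instance] Matrix.frobeniusNormedRing Matrix.frobeniusNormedAlgebra

variable {n : ℕ}

lemma trace_mul_toMatrix_eq_inner (A B : E n) :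
    (A.toMatrix * B.toMatrix).trace = inner ℝ A B :=
  congrArg (fun M => (M * B.toMatrix).trace) A.2.1.symm

/-- The differential at `A` of `X ↦ (tr X³, tr X⁵, …)`, the extension of `Phi n` to `E n`. -/
noncomputable def phiDeriv (A : E n) : E n →L[ℝ] EuclideanSpace ℝ (Fin ((n - 1) / 2)) :=
  (EuclideanSpace.equiv _ ℝ).symm.toContinuousLinearMap ∘L
    ContinuousLinearMap.pi fun k : Fin ((n - 1) / 2) =>
      (((2 * ((k : ℕ) + 1) : ℕ) + 1 : ℝ) • tracePowMul A.toMatrix (2 * ((k : ℕ) + 1))) ∘L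
        LinearMap.toContinuousLinearMap E.toMatrix

lemma phiDeriv_apply (A B : E n) (k : Fin ((n - 1) / 2)) :
    phiDeriv A B k =
      ((2 * ((k : ℕ) + 1) : ℕ) + 1) * (A.toMatrix ^ (2 * ((k : ℕ) + 1)) * B.toMatrix).trace :=
  rfl

lemma hasFDerivAt_phiDeriv (A : E n) :
    HasFDerivAt (fun X : E n => (WithLp.toLp 2 fun k : Fin ((n - 1) / 2) =>
      (X.toMatrix ^ (2 * ((k : ℕ) + 1) + 1)).trace : EuclideanSpace ℝ (Fin ((n - 1) / 2))))
      (phiDeriv A) A := by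
  rw [← hasFDerivWithinAt_univ, hasFDerivWithinAt_euclidean]
  exact fun k => ((hasFDerivAt_trace_pow A.toMatrix (2 * ((k : ℕ) + 1))).comp A
    (LinearMap.toContinuousLinearMap E.toMatrix).hasFDerivAt).hasFDerivWithinAt

lemma mfderiv_Phi {m : ℕ} [Fact (Module.finrank ℝ (E n) = m + 1)] (A : unitSphere n) :
    mfderiv (𝓡 m) 𝓘(ℝ, EuclideanSpace ℝ (Fin ((n - 1) / 2))) (Phi n) A =
      phiDeriv (A : E n) ∘L mfderiv (𝓡 m) 𝓘(ℝ, E n) (Subtype.val : unitSphere n → E n) A :=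
  ((hasFDerivAt_phiDeriv (A : E n)).hasMFDerivAt.comp A
    ((contMDiff_coe_sphere A).mdifferentiableAt one_ne_zero).hasMFDerivAt).mfderiv

lemma isRegularPoint_iff_surjOn_phiDeriv {A : unitSphere n} :
    IsRegularPoint A ↔ Set.SurjOn (phiDeriv (A : E n)) (ℝ ∙ (A : E n))ᗮ Set.univ := by
  have : Fact (Module.finrank ℝ (E n) = (Module.finrank ℝ (E n) - 1) + 1) := ⟨finrank_eq A⟩
  unfold IsRegularPoint
  rw [mfderiv_Phi, ← range_mvfderiv_subtypeVal (n := Module.finrank ℝ (E n) - 1) A]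
  rw [Set.SurjOn, LinearMap.coe_range, ← Set.range_comp, Set.univ_subset_iff, Set.range_eq_univ]
  rfl

lemma isRegularPoint_iff {A : unitSphere n} :
    IsRegularPoint A ↔ ∀ c : Fin ((n - 1) / 2) → ℝ, ∃ B : E n,
      ((A : E n).toMatrix * B.toMatrix).trace = 0 ∧
        ∀ k : Fin ((n - 1) / 2),
          ((A : E n).toMatrix ^ (2 * ((k : ℕ) + 1)) * B.toMatrix).trace = c k := by
  simp only [isRegularPoint_iff_surjOn_phiDeriv, trace_mul_toMatrix_eq_inner,
    ← Submodule.mem_orthogonal_singleton_iff_inner_right]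
  have hpos (k : Fin ((n - 1) / 2)) : ((2 * ((k : ℕ) + 1) : ℕ) + 1 : ℝ) ≠ 0 := by positivity
  constructor
  · intro h c
    obtain ⟨B, hB, hBc⟩ := h (Set.mem_univ (WithLp.toLp 2 fun k : Fin ((n - 1) / 2) =>
      ((2 * ((k : ℕ) + 1) : ℕ) + 1 : ℝ) * c k))
    exact ⟨B, hB, fun k => mul_left_cancel₀ (hpos k) (congrArg (fun w => w k) hBc)⟩
  · intro h c _
    obtain ⟨B, hB, hBc⟩ := h fun k => c k / ((2 * ((k : ℕ) + 1) : ℕ) + 1 : ℝ)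
    refine ⟨B, hB, ?_⟩
    ext k
    rw [phiDeriv_apply, hBc, mul_div_cancel₀ _ (hpos k)]

lemma norm_eq_one_iff_trace_sq {A : E n} : ‖A‖ = 1 ↔ (A.toMatrix ^ 2).trace = 1 := by
  rw [sq, trace_mul_toMatrix_eq_inner, real_inner_self_eq_norm_sq,
    pow_eq_one_iff_of_nonneg (norm_nonneg A) two_ne_zero]

lemma IsRegularPoint.linearIndependent_pow {A : unitSphere n} (hA : IsRegularPoint A) :
    LinearIndependent ℝ fun k : Fin ((n - 1) / 2 + 1) => (A : E n).toMatrix ^ (2 * (k : ℕ)) := by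
  rw [Fintype.linearIndependent_iff]
  intro g hg
  obtain ⟨B, -, hB⟩ := isRegularPoint_iff.mp hA fun k => g k.succ
  have htrB : B.toMatrix.trace = 0 := B.2.2
  have hsq : ∑ k : Fin ((n - 1) / 2), g k.succ ^ 2 = 0 := by
    have htr := congrArg (fun M => (M * B.toMatrix).trace) hg
    simp only [Fin.sum_univ_succ, Fin.val_zero, Fin.val_succ, mul_zero, pow_zero, add_mul,
      Finset.sum_mul, smul_mul_assoc, one_mul, zero_mul, Matrix.trace_add, Matrix.trace_sum,
      Matrix.trace_smul, Matrix.trace_zero, htrB, hB, smul_eq_mul, zero_add, ← sq] at htr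
    exact htr
  have hsucc (k : Fin ((n - 1) / 2)) : g k.succ = 0 :=
    pow_eq_zero_iff two_ne_zero |>.mp <|
      (Finset.sum_eq_zero_iff_of_nonneg fun k _ => sq_nonneg (g k.succ)).mp hsq k
        (Finset.mem_univ k)
  have hzero : g 0 • (A : E n) = 0 := by
    simp only [Fin.sum_univ_succ, hsucc, zero_smul, Finset.sum_const_zero, add_zero,
      Fin.val_zero, mul_zero, pow_zero] at hg
    have hmul := congrArg (· * (A : E n).toMatrix) hg
    simp only [smul_mul_assoc, one_mul, zero_mul] at hmul
    exact Subtype.ext hmul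
  exact Fin.cases ((smul_eq_zero.mp hzero).resolve_right (ne_zero_of_mem_unit_sphere A)) hsucc

attribute [local instance] frobeniusInner in
lemma exists_forall_trace_transpose_mul_sum_smul_eq {κ : Type*} [Fintype κ]
    {v : κ → Matrix (Fin n) (Fin n) ℝ} (hv : LinearIndependent ℝ v) (c : κ → ℝ) :
    ∃ x : κ → ℝ, ∀ i, ((v i)ᵀ * ∑ j, x j • v j).trace = c i :=
  exists_forall_inner_sum_smul_eq hv c

lemma trace_pow_eq_zero_of_Phi_eq_zero {A : unitSphere n} (hA : Phi n A = 0)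
    (k : Fin ((n - 1) / 2 + 1)) : ((A : E n).toMatrix ^ (2 * (k : ℕ) + 1)).trace = 0 := by
  induction k using Fin.cases with
  | zero => rw [Fin.val_zero, mul_zero, zero_add, pow_one]; exact (A : E n).2.2
  | succ k => exact congrArg (fun w => w k) hA

-- The required tangent vector is found among the combinations of `1, A ^ 2, A ^ 4, …`, which are
-- orthogonal to `A` because the odd traces of `A` vanish.
lemma isRegularPoint_of_linearIndependent_pow {A : unitSphere n} (hA : Phi n A = 0)
    (hli : LinearIndependent ℝ fun k : Fin ((n - 1) / 2 + 1) =>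
      (A : E n).toMatrix ^ (2 * (k : ℕ))) : IsRegularPoint A := by
  have hsymm (m : ℕ) : ((A : E n).toMatrix ^ m)ᵀ = (A : E n).toMatrix ^ m :=
    (Matrix.transpose_pow _ m).trans (congrArg (· ^ m) (A : E n).2.1)
  refine isRegularPoint_iff.mpr fun c => ?_
  obtain ⟨x, hx⟩ := exists_forall_trace_transpose_mul_sum_smul_eq hli (Fin.cons 0 c)
  simp only [hsymm] at hx
  let B : E n := ⟨∑ k, x k • (A : E n).toMatrix ^ (2 * (k : ℕ)), by
    rw [Matrix.IsSymm, Matrix.transpose_sum]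
    simp only [Matrix.transpose_smul, hsymm], by simpa using hx 0⟩
  refine ⟨B, ?_, fun k => hx k.succ⟩
  change ((A : E n).toMatrix * ∑ k, x k • (A : E n).toMatrix ^ (2 * (k : ℕ))).trace = 0
  simp only [Finset.mul_sum, mul_smul_comm, ← pow_succ', Matrix.trace_sum, Matrix.trace_smul,
    trace_pow_eq_zero_of_Phi_eq_zero hA, smul_zero, Finset.sum_const_zero]

end RegularPoints

section SeparatedEigenvalues

variable {n : ℕ} {a : Fin n → ℝ}

-- An even power of `a` factors through the fold `i ↦ min i (n - 1 - i)`, whose values serve as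
-- Vandermonde nodes.
lemma eq_or_eq_rev_of_sq_eq_sq (ha : ∀ i, a i.rev = -a i)
    (hli : LinearIndependent ℝ fun k : Fin ((n - 1) / 2 + 1) => a ^ (2 * (k : ℕ)))
    {i j : Fin n} (hij : a i ^ 2 = a j ^ 2) : j = i ∨ j = i.rev := by
  have hn : 0 < n := i.pos
  let fold : Fin n → Fin ((n - 1) / 2 + 1) := fun i => ⟨min i (n - 1 - i), by omega⟩
  let unfold : Fin ((n - 1) / 2 + 1) → Fin n := fun m => ⟨m, by omega⟩
  have hunfold (i : Fin n) : unfold (fold i) = i ∨ unfold (fold i) = i.rev := by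
    simp only [unfold, fold, Fin.ext_iff, Fin.val_rev]
    omega
  have hsq (i : Fin n) : a (unfold (fold i)) ^ 2 = a i ^ 2 := by
    rcases hunfold i with h | h <;> simp only [h, ha, neg_sq]
  have hinj : Function.Injective fun m => a (unfold m) ^ 2 := by
    rw [← linearIndependent_pow_iff_injective (K := ℝ)]
    refine LinearIndependent.of_comp (LinearMap.funLeft ℝ ℝ fold) (?_ : LinearIndependent ℝ _)
    have hcomp : (LinearMap.funLeft ℝ ℝ fold ∘ fun k : Fin ((n - 1) / 2 + 1) =>
        (fun m => a (unfold m) ^ 2) ^ (k : ℕ)) =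
          fun k : Fin ((n - 1) / 2 + 1) => a ^ (2 * (k : ℕ)) := by
      ext k i
      simp only [Function.comp_apply, LinearMap.funLeft_apply, Pi.pow_apply, hsq, pow_mul]
    exact hcomp ▸ hli
  have hfold : fold i = fold j := hinj (by simpa only [hsq] using hij)
  simp only [fold, Fin.ext_iff, Fin.val_rev] at hfold ⊢
  omega

lemma add_rev_eq_zero_of_sum_pow_mul_eq_zero (ha : ∀ i, a i.rev = -a i)
    (hsep : ∀ i j, a i ^ 2 = a j ^ 2 → j = i ∨ j = i.rev) {d : Fin n → ℝ}
    (hd : ∀ k : ℕ, ∑ i, a i ^ (2 * k) * d i = 0) (i : Fin n) : d i + d i.rev = 0 := by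
  have hfiber : Finset.univ.filter (fun j => a j ^ 2 = a i ^ 2) = {i, i.rev} := by
    ext j
    simp only [Finset.mem_filter, Finset.mem_univ, true_and, Finset.mem_insert,
      Finset.mem_singleton]
    refine ⟨fun h => hsep i j h.symm, ?_⟩
    rintro (rfl | rfl)
    · rfl
    · rw [ha, neg_sq]
  have hsum := sum_filter_eq_zero_of_sum_pow_mul_eq_zero (f := fun j => a j ^ 2) (d := d)
    (by simpa only [← pow_mul] using hd) (a i ^ 2)
  rw [hfiber] at hsum
  rcases eq_or_ne i i.rev with hi | hi
  · rw [← hi, Finset.pair_eq_singleton, Finset.sum_singleton] at hsum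
    rw [← hi, hsum, add_zero]
  · rwa [Finset.sum_pair hi] at hsum

lemma add_neg_of_le_add (ha : Antitone a) (harev : ∀ i, a i.rev = -a i)
    (hsep : ∀ i j, a i ^ 2 = a j ^ 2 → j = i ∨ j = i.rev) {i j : Fin n} (hij : i ≠ j)
    (hn : n ≤ (i : ℕ) + j) : a i + a j < 0 := by
  have hle := ha (show j.rev ≤ i by rw [Fin.le_def, Fin.val_rev]; omega)
  rw [harev] at hle
  refine lt_of_le_of_ne (by linarith) fun h => ?_
  rcases hsep i j (by rw [eq_neg_of_add_eq_zero_left h, neg_sq]) with rfl | rfl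
  · exact hij rfl
  · rw [Fin.val_rev] at hn; omega

end SeparatedEigenvalues

section DimensionBound

lemma sum_add_mul_sq_eq_two_mul_trace {ι R : Type*} [Fintype ι] [DecidableEq ι] [CommRing R]
    (a : ι → R) {D : Matrix ι ι R} (hD : D.IsSymm) :
    ∑ i, ∑ j, (a i + a j) * D i j ^ 2 = 2 * (Matrix.diagonal a * (D * D)).trace := by
  have hleft : ∑ i, ∑ j, a i * D i j ^ 2 = (Matrix.diagonal a * (D * D)).trace := by
    simp only [Matrix.trace, Matrix.diag_apply, Matrix.diagonal_mul]
    simp only [Matrix.mul_apply, Finset.mul_sum, hD.apply, sq]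
  have hright : ∑ i, ∑ j, a j * D i j ^ 2 = ∑ i, ∑ j, a i * D i j ^ 2 := by
    rw [Finset.sum_comm]
    simp only [hD.apply]
  simp only [add_mul, Finset.sum_add_distrib, hright, hleft, two_mul]

lemma eq_zero_of_trace_diagonal_mul_sq_eq_zero {ι R : Type*} [Fintype ι] [DecidableEq ι]
    [CommRing R] [LinearOrder R] [IsStrictOrderedRing R] {a : ι → R} {D : Matrix ι ι R}
    (hD : D.IsSymm) (hneg : ∀ i j, a i + a j < 0 ∨ D i j = 0)
    (htr : (Matrix.diagonal a * (D * D)).trace = 0) : D = 0 := by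
  have hterm (i j : ι) : (a i + a j) * D i j ^ 2 ≤ 0 := by
    rcases hneg i j with h | h
    · exact mul_nonpos_of_nonpos_of_nonneg h.le (sq_nonneg _)
    · simp [h]
  have hsum := sum_add_mul_sq_eq_two_mul_trace a hD
  rw [htr, mul_zero, ← Fintype.sum_prod_type', Finset.sum_eq_zero_iff_of_nonpos
    fun p _ => hterm p.1 p.2] at hsum
  ext i j
  rcases hneg i j with h | h
  · exact (pow_eq_zero_iff two_ne_zero).mp
      ((mul_eq_zero.mp (hsum (i, j) (Finset.mem_univ _))).resolve_left h.ne)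
  · exact h

lemma sum_range_two_mul_add_sub (m r : ℕ) :
    ∑ i ∈ Finset.range m, (2 * m + r - 2 * i) = m * (m + 1 + r) := by
  induction m with
  | zero => simp
  | succ m ih =>
    have hshift (i : ℕ) : 2 * (m + 1) + r - 2 * (i + 1) = 2 * m + r - 2 * i := by omega
    simp only [Finset.sum_range_succ', hshift, ih, mul_zero, Nat.sub_zero]
    ring

/-- The entries of a matrix that lie weakly above both diagonals, apart from the central one: the
family at `⟨i, s⟩` is the entry `(i, i + s)`, where `i < ⌊n / 2⌋` and `2 * i + s < n`. -/
noncomputable def upperEntries (n : ℕ) :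
    Matrix (Fin n) (Fin n) ℝ →ₗ[ℝ] (Σ i : Fin (n / 2), Fin (n - 2 * i)) → ℝ :=
  LinearMap.pi fun s => Matrix.entryLinearMap ℝ ℝ ⟨s.1, by omega⟩ ⟨s.1 + s.2, by omega⟩

variable {n : ℕ}

lemma apply_eq_zero_of_upperEntries_eq_zero {D : Matrix (Fin n) (Fin n) ℝ}
    (hD : upperEntries n D = 0) {i j : Fin n} (hij : i ≤ j) (hlt : (i : ℕ) + j < n)
    (hi : 2 * (i : ℕ) + 1 < n) : D i j = 0 := by
  rw [Fin.le_def] at hij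
  have hentry := congrFun hD ⟨⟨i, by omega⟩, ⟨j - i, by simp only; omega⟩⟩
  have hj : (⟨i + (j - i), by omega⟩ : Fin n) = j := by
    ext; simp only; omega
  rw [← hj]
  exact hentry

namespace IsAustereSubspace

variable {Q : Submodule ℝ (Matrix (Fin n) (Fin n) ℝ)} {a : Fin n → ℝ}

lemma diag_add_diag_rev_eq_zero (hQ : IsAustereSubspace Q) (ha : Antitone a)
    (hA : Matrix.diagonal a ∈ Q) (hsep : ∀ i j, a i ^ 2 = a j ^ 2 → j = i ∨ j = i.rev)
    {D : Matrix (Fin n) (Fin n) ℝ} (hD : D ∈ Q) (i : Fin n) : D i i + D i.rev i.rev = 0 := by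
  refine add_rev_eq_zero_of_sum_pow_mul_eq_zero ((hQ _ hA).apply_rev_eq_neg ha) hsep
    (d := D.diag) (fun k => ?_) i
  simpa only [Matrix.diagonal_pow, Matrix.trace, Matrix.diag_apply, Matrix.diagonal_mul,
    Pi.pow_apply] using hQ.trace_pow_mul_eq_zero hA hD (even_two_mul k)

lemma eq_zero_of_upperEntries_eq_zero (hQ : IsAustereSubspace Q) (ha : Antitone a)
    (hA : Matrix.diagonal a ∈ Q) (hsep : ∀ i j, a i ^ 2 = a j ^ 2 → j = i ∨ j = i.rev)
    {D : Matrix (Fin n) (Fin n) ℝ} (hD : D ∈ Q) (hzero : upperEntries n D = 0) : D = 0 := by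
  have hdiag (i : Fin n) : D i i = 0 := by
    have hrev := hQ.diag_add_diag_rev_eq_zero ha hA hsep hD i
    rcases lt_trichotomy i i.rev with hi | hi | hi
    · rw [Fin.lt_def, Fin.val_rev] at hi
      exact apply_eq_zero_of_upperEntries_eq_zero hzero le_rfl (by omega) (by omega)
    · rwa [← hi, add_self_eq_zero] at hrev
    · rw [Fin.lt_def, Fin.val_rev] at hi
      rwa [apply_eq_zero_of_upperEntries_eq_zero hzero (le_refl i.rev) (by rw [Fin.val_rev]; omega)
        (by rw [Fin.val_rev]; omega), add_zero] at hrev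
  have hupper {i j : Fin n} (hij : i < j) (hlt : (i : ℕ) + j < n) : D i j = 0 :=
    apply_eq_zero_of_upperEntries_eq_zero hzero hij.le hlt (by rw [Fin.lt_def] at hij; omega)
  refine eq_zero_of_trace_diagonal_mul_sq_eq_zero (hQ D hD).1 (fun i j => ?_)
    (hQ.trace_mul_sq_eq_zero hA hD)
  rcases le_or_gt n ((i : ℕ) + j) with hn | hn <;> rcases lt_trichotomy i j with hij | rfl | hij
  · exact .inl (add_neg_of_le_add ha ((hQ _ hA).apply_rev_eq_neg ha) hsep hij.ne hn)
  · exact .inr (hdiag i)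
  · exact .inl (add_neg_of_le_add ha ((hQ _ hA).apply_rev_eq_neg ha) hsep hij.ne' hn)
  · exact .inr (hupper hij hn)
  · exact .inr (hdiag i)
  · exact .inr (((hQ D hD).1.apply j i).trans (hupper hij (by omega)))

lemma finrank_le_of_diagonal_mem (hQ : IsAustereSubspace Q) (ha : Antitone a)
    (hA : Matrix.diagonal a ∈ Q) (hsep : ∀ i j, a i ^ 2 = a j ^ 2 → j = i ∨ j = i.rev) :
    Module.finrank ℝ Q ≤ n / 2 * ((n + 1) / 2 + 1) := by
  have hinj : Function.Injective (upperEntries n ∘ₗ Q.subtype) :=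
    (injective_iff_map_eq_zero _).mpr fun D hD =>
      Subtype.ext (hQ.eq_zero_of_upperEntries_eq_zero ha hA hsep D.2 hD)
  calc Module.finrank ℝ Q
      ≤ ∑ i : Fin (n / 2), (n - 2 * i) := by
        simpa only [Module.finrank_fintype_fun_eq_card, Fintype.card_sigma, Fintype.card_fin]
          using LinearMap.finrank_le_finrank_of_injective hinj
    _ = ∑ i ∈ Finset.range (n / 2), (2 * (n / 2) + n % 2 - 2 * i) := by
        rw [Nat.div_add_mod, Fin.sum_univ_eq_sum_range fun i => n - 2 * i]
    _ = n / 2 * ((n + 1) / 2 + 1) := by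
        rw [sum_range_two_mul_add_sub]
        congr 1
        omega

lemma comap_conjStarAlgAut (hQ : IsAustereSubspace Q) (V : Matrix.orthogonalGroup (Fin n) ℝ) :
    IsAustereSubspace (Q.comap (Unitary.conjStarAlgAut ℝ _ V).toAlgEquiv.toLinearMap) :=
  fun _ hA => (isAustere_conjStarAlgAut_iff V).mp (hQ _ hA)

theorem finrank_le (hQ : IsAustereSubspace Q)
    (hreg : ((Q : Set (Matrix (Fin n) (Fin n) ℝ)) ∩ regularSet n).Nonempty) :
    Module.finrank ℝ Q ≤ n / 2 * ((n + 1) / 2 + 1) := by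
  obtain ⟨_, hAQ, A, rfl, -, hA⟩ := hreg
  obtain ⟨V, a, ha, hAV : (A : E n).toMatrix = _⟩ :=
    exists_antitone_eq_conjStarAlgAut_diagonal (A : E n).2.1
  let φ := (Unitary.conjStarAlgAut ℝ _ V).toAlgEquiv
  have hQV := hQ.comap_conjStarAlgAut V
  have haQ : Matrix.diagonal a ∈ Q.comap φ.toLinearMap := by
    rw [hAV] at hAQ
    exact hAQ
  have hli : LinearIndependent ℝ fun k : Fin ((n - 1) / 2 + 1) => a ^ (2 * (k : ℕ)) := by
    have hpow := hA.linearIndependent_pow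
    simp only [hAV, ← map_pow, Matrix.diagonal_pow] at hpow
    exact hpow.of_comp (φ.toLinearMap ∘ₗ Matrix.diagonalLinearMap (Fin n) ℝ ℝ)
  have hsep (i j : Fin n) : a i ^ 2 = a j ^ 2 → j = i ∨ j = i.rev :=
    eq_or_eq_rev_of_sq_eq_sq ((hQV _ haQ).apply_rev_eq_neg ha) hli
  calc Module.finrank ℝ Q
      = Module.finrank ℝ (Q.comap φ.toLinearMap) := by
        rw [← LinearEquiv.finrank_map_eq φ.toLinearEquiv.symm Q,
          Submodule.map_equiv_eq_comap_symm]
        rfl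
    _ ≤ n / 2 * ((n + 1) / 2 + 1) := hQV.finrank_le_of_diagonal_mem ha haQ hsep

end IsAustereSubspace

end DimensionBound

section BlockSpace

lemma charpoly_neg_fromBlocks {κ R : Type*} [Fintype κ] [DecidableEq κ] [CommRing R]
    (m₁ m₂ : Matrix κ κ R) :
    (-Matrix.fromBlocks m₁ m₂ m₂ (-m₁)).charpoly =
      (Matrix.fromBlocks m₁ m₂ m₂ (-m₁)).charpoly := by
  have hconj : -Matrix.fromBlocks m₁ m₂ m₂ (-m₁) =
      Matrix.fromBlocks 0 1 (-1) 0 * Matrix.fromBlocks m₁ m₂ m₂ (-m₁) *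
        Matrix.fromBlocks 0 (-1) 1 0 := by
    simp [Matrix.fromBlocks_neg, Matrix.fromBlocks_multiply]
  have hinv : Matrix.fromBlocks 0 (-1) 1 0 * Matrix.fromBlocks 0 1 (-1) 0 =
      (1 : Matrix (κ ⊕ κ) (κ ⊕ κ) R) := by
    simp [Matrix.fromBlocks_multiply]
  rw [hconj, Matrix.charpoly_mul_comm, ← mul_assoc, hinv, one_mul]

/-- Symmetric matrices, given by their entries as functions on unordered pairs of indices. -/
def symMatrix (ι R : Type*) [Semiring R] : (Sym2 ι → R) →ₗ[R] Matrix ι ι R where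
  toFun f := Matrix.of fun i j => f s(i, j)
  map_add' _ _ := rfl
  map_smul' _ _ := rfl

lemma symMatrix_injective (ι R : Type*) [Semiring R] : Function.Injective (symMatrix ι R) :=
  fun _ _ h => funext <| Sym2.ind fun i j => congrFun (congrFun h i) j

lemma mem_range_symMatrix_iff {ι R : Type*} [Semiring R] {M : Matrix ι ι R} :
    M ∈ (symMatrix ι R).range ↔ M.IsSymm := by
  constructor
  · rintro ⟨f, rfl⟩
    exact Matrix.IsSymm.ext fun i j => congrArg f Sym2.eq_swap
  · exact fun hM => ⟨Sym2.lift ⟨M, fun i j => hM.apply j i⟩, rfl⟩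

variable {k : ℕ}

/-- The numbering of the rows and columns of a block matrix used in `blockMatrix`. -/
abbrev blockIndexEquiv (k : ℕ) : Fin k ⊕ Fin k ≃ Fin (2 * k) :=
  finSumFinEquiv.trans (finCongr (two_mul k).symm)

lemma isAustereSubspace_blockSubspace (k : ℕ) : IsAustereSubspace (blockSubspace k) := by
  rintro _ ⟨m₁, m₂, h₁, h₂, rfl⟩
  refine isAustere_iff_map_neg_roots.mpr ⟨(Matrix.IsSymm.fromBlocks h₁ h₂ h₁.neg).submatrix _, ?_⟩
  have hneg : -blockMatrix m₁ m₂ = Matrix.reindex (blockIndexEquiv k) (blockIndexEquiv k)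
      (-Matrix.fromBlocks m₁ m₂ m₂ (-m₁)) := rfl
  rw [← roots_charpoly_neg, hneg, Matrix.charpoly_reindex, charpoly_neg_fromBlocks, blockMatrix,
    Matrix.charpoly_reindex]

/-- `blockMatrix` as a linear map of the pair of blocks. -/
noncomputable def blockMatrixLinearMap (k : ℕ) :
    Matrix (Fin k) (Fin k) ℝ × Matrix (Fin k) (Fin k) ℝ →ₗ[ℝ]
      Matrix (Fin (2 * k)) (Fin (2 * k)) ℝ where
  toFun m := blockMatrix m.1 m.2
  map_add' m m' := by
    have hadd := Matrix.fromBlocks_add m.1 m.2 m.2 (-m.1) m'.1 m'.2 m'.2 (-m'.1)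
    rw [← neg_add] at hadd
    exact congrArg (Matrix.reindex (blockIndexEquiv k) (blockIndexEquiv k)) hadd.symm
  map_smul' c m := by
    have hsmul := Matrix.fromBlocks_smul c m.1 m.2 m.2 (-m.1)
    rw [smul_neg] at hsmul
    exact congrArg (Matrix.reindex (blockIndexEquiv k) (blockIndexEquiv k)) hsmul.symm

lemma blockMatrixLinearMap_injective (k : ℕ) : Function.Injective (blockMatrixLinearMap k) := by
  intro m m' h
  obtain ⟨h₁, h₂, -⟩ := Matrix.fromBlocks_inj.mp ((Matrix.reindex _ _).injective h)
  exact Prod.ext h₁ h₂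

lemma blockSubspace_eq_range (k : ℕ) :
    blockSubspace k = (blockMatrixLinearMap k ∘ₗ
      (symMatrix (Fin k) ℝ).prodMap (symMatrix (Fin k) ℝ)).range := by
  ext A
  constructor
  · rintro ⟨m₁, m₂, h₁, h₂, rfl⟩
    obtain ⟨f₁, rfl⟩ := mem_range_symMatrix_iff.mpr h₁
    obtain ⟨f₂, rfl⟩ := mem_range_symMatrix_iff.mpr h₂
    exact ⟨(f₁, f₂), rfl⟩
  · rintro ⟨f, rfl⟩
    exact ⟨_, _, mem_range_symMatrix_iff.mp ⟨f.1, rfl⟩, mem_range_symMatrix_iff.mp ⟨f.2, rfl⟩, rfl⟩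

lemma finrank_blockSubspace (k : ℕ) : Module.finrank ℝ (blockSubspace k) = k * (k + 1) := by
  have hinj : Function.Injective (blockMatrixLinearMap k ∘ₗ
      (symMatrix (Fin k) ℝ).prodMap (symMatrix (Fin k) ℝ)) :=
    (blockMatrixLinearMap_injective k).comp
      ((symMatrix_injective (Fin k) ℝ).prodMap (symMatrix_injective (Fin k) ℝ))
  rw [blockSubspace_eq_range, LinearMap.finrank_range_of_inj hinj, Module.finrank_prod,
    Module.finrank_fintype_fun_eq_card, Sym2.card, Fintype.card_fin, ← mul_two,
    Nat.choose_two_right, Nat.div_mul_cancel (Nat.even_mul_pred_self (k + 1)).two_dvd,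
    Nat.add_sub_cancel, mul_comm]

lemma blockMatrix_diagonal_zero (u : Fin k → ℝ) :
    blockMatrix (Matrix.diagonal u) 0 =
      Matrix.diagonal (Sum.elim u (-u) ∘ (blockIndexEquiv k).symm) := by
  have hneg : -Matrix.diagonal u = Matrix.diagonal (-u) := Matrix.diagonal_neg u
  rw [blockMatrix, Matrix.reindex_apply, hneg, Matrix.fromBlocks_diagonal,
    Matrix.submatrix_diagonal_equiv]

lemma trace_blockMatrix_diagonal_zero_sq (u : Fin k → ℝ) :
    (blockMatrix (Matrix.diagonal u) 0 ^ 2).trace = 2 * ∑ i, u i ^ 2 := by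
  rw [blockMatrix_diagonal_zero, Matrix.diagonal_pow, Matrix.trace_diagonal,
    ← Equiv.sum_comp (blockIndexEquiv k), Fintype.sum_sum_type,
    two_mul (∑ i, u i ^ 2)]
  simp only [Pi.pow_apply, Function.comp_apply, Equiv.symm_apply_apply, Sum.elim_inl, Sum.elim_inr,
    Pi.neg_apply, neg_sq]

lemma linearIndependent_blockMatrix_diagonal_zero_pow {u : Fin k → ℝ}
    (hu : Function.Injective (u ^ 2)) :
    LinearIndependent ℝ fun j : Fin k => blockMatrix (Matrix.diagonal u) 0 ^ (2 * (j : ℕ)) := by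
  have hpow := (linearIndependent_pow_iff_injective _).mpr hu
  refine LinearIndependent.of_comp (LinearMap.funLeft ℝ ℝ (blockIndexEquiv k ∘ Sum.inl) ∘ₗ
    Matrix.diagLinearMap (Fin (2 * k)) ℝ ℝ) ?_
  have hcomp : ((LinearMap.funLeft ℝ ℝ (blockIndexEquiv k ∘ Sum.inl) ∘ₗ
      Matrix.diagLinearMap (Fin (2 * k)) ℝ ℝ) ∘ fun j : Fin k =>
        blockMatrix (Matrix.diagonal u) 0 ^ (2 * (j : ℕ))) =
          fun j : Fin k => (u ^ 2) ^ (j : ℕ) := by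
    ext j i
    simp [blockMatrix_diagonal_zero, Matrix.diagonal_pow, LinearMap.funLeft_apply, pow_mul]
  rwa [hcomp]

lemma exists_injective_sq_sum_sq_eq (k : ℕ) [NeZero k] {c : ℝ} (hc : 0 < c) :
    ∃ u : Fin k → ℝ, Function.Injective (u ^ 2) ∧ ∑ i, u i ^ 2 = c := by
  let S : ℝ := ∑ i : Fin k, ((i : ℝ) + 1)
  have hS : 0 < S := Finset.sum_pos (fun i _ => by positivity) Finset.univ_nonempty
  have hsq (i : Fin k) : √(c / S * (i + 1)) ^ 2 = c / S * (i + 1) := Real.sq_sqrt (by positivity)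
  refine ⟨fun i => √(c / S * (i + 1)), fun i j hij => ?_, ?_⟩
  · simp only [Pi.pow_apply, hsq] at hij
    exact Fin.ext (Nat.cast_injective (add_right_cancel (mul_left_cancel₀ (div_pos hc hS).ne' hij)))
  · simp only [hsq]
    rw [← Finset.mul_sum, div_mul_cancel₀ c hS.ne']

lemma blockSubspace_inter_regularSet_nonempty (k : ℕ) [NeZero k] :
    ((blockSubspace k : Set (Matrix (Fin (2 * k)) (Fin (2 * k)) ℝ)) ∩
      regularSet (2 * k)).Nonempty := by
  obtain ⟨u, hu, hsum⟩ := exists_injective_sq_sum_sq_eq k (c := 1 / 2) one_half_pos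
  have hmem : blockMatrix (Matrix.diagonal u) 0 ∈ blockSubspace k :=
    ⟨_, _, Matrix.isSymm_diagonal u, Matrix.isSymm_zero, rfl⟩
  have haustere := isAustereSubspace_blockSubspace k _ hmem
  have htr : (blockMatrix (Matrix.diagonal u) 0).trace = 0 := by
    simpa only [pow_one] using haustere.trace_pow_eq_zero odd_one
  let A : E (2 * k) := ⟨_, haustere.1, htr⟩
  have hA : A ∈ unitSphere (2 * k) := by
    rw [mem_sphere_zero_iff_norm, norm_eq_one_iff_trace_sq]
    exact (trace_blockMatrix_diagonal_zero_sq u).trans (by rw [hsum]; norm_num)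
  have hPhi : Phi (2 * k) ⟨A, hA⟩ = 0 := by
    ext j
    exact haustere.trace_pow_eq_zero (odd_two_mul_add_one _)
  have hk : (2 * k - 1) / 2 + 1 = k := by
    have := NeZero.pos k
    omega
  have hli := (linearIndependent_blockMatrix_diagonal_zero_pow hu).comp _ (Fin.cast_injective hk)
  exact ⟨_, hmem, ⟨A, hA⟩, rfl, hPhi, isRegularPoint_of_linearIndependent_pow hPhi hli⟩

theorem maximal_blockSubspace (k : ℕ) [NeZero k] :
    Maximal IsAustereSubspace (blockSubspace k) := by
  refine ⟨isAustereSubspace_blockSubspace k, fun Q hQ hle => ?_⟩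
  have hdim := hQ.finrank_le ((blockSubspace_inter_regularSet_nonempty k).mono
    (Set.inter_subset_inter_left _ hle))
  have hcard : 2 * k / 2 * ((2 * k + 1) / 2 + 1) = Module.finrank ℝ (blockSubspace k) := by
    rw [finrank_blockSubspace]
    congr 1 <;> omega
  exact (Submodule.eq_of_le_of_finrank_le hle (hdim.trans_eq hcard)).ge

end BlockSpace

end Austere

theorem mainTheorem2 :
    (∀ (n : ℕ) (Q : Submodule ℝ (Matrix (Fin n) (Fin n) ℝ)),
      Austere.IsAustereSubspace Q →
      ((Q : Set (Matrix (Fin n) (Fin n) ℝ)) ∩ Austere.regularSet n).Nonempty →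
      ∀ p : ℕ,
        (n = 2 * p + 1 → Module.finrank ℝ Q ≤ p ^ 2 + 2 * p) ∧
        (n = 2 * p + 2 → Module.finrank ℝ Q ≤ p ^ 2 + 3 * p + 2)) ∧
    (∀ p : ℕ,
      Maximal Austere.IsAustereSubspace (Austere.blockSubspace (p + 1)) ∧
      ((Austere.blockSubspace (p + 1) :
          Set (Matrix (Fin (2 * (p + 1))) (Fin (2 * (p + 1))) ℝ)) ∩
        Austere.regularSet (2 * (p + 1))).Nonempty ∧
      Module.finrank ℝ (Austere.blockSubspace (p + 1)) = p ^ 2 + 3 * p + 2) := by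
  refine ⟨fun n Q hQ hreg p => ?_, fun p => ⟨Austere.maximal_blockSubspace (p + 1),
    Austere.blockSubspace_inter_regularSet_nonempty (p + 1), ?_⟩⟩
  · have hbound := hQ.finrank_le hreg
    constructor <;> rintro rfl
    · rw [show (2 * p + 1) / 2 = p by omega, show (2 * p + 1 + 1) / 2 = p + 1 by omega] at hbound
      linarith
    · rw [show (2 * p + 2) / 2 = p + 1 by omega, show (2 * p + 2 + 1) / 2 = p + 1 by omega]
        at hbound
      linarith
  · rw [Austere.finrank_blockSubspace]
    ring
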